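/- A Wigner ensemble is a family of real symmetric random matrices $\tilde X_N=(\tilde X_N(i,j))_{1\le i,j\le N}$, $N\ge 1$, on one probability space $(\Omega,\mathcal F,\mathbb P)$ such that for each $N$ the entries $\tilde X_N(i,j)$, $1\le i\le j\le N$, are independent, all entries (for all $N,i,j$) have the same distribution, $\mathbb E(\tilde X_N(i,j))=0$ and $\mathbb E(\tilde X_N(i,j)^2)=1$. Let $b_N$ be non-negative integers with $b_N\to\infty$ and with $\beta_N:=2b_N+1\le N$ for all $N\ge1$. Given a Wigner ensemble $\tilde X_N$, the banded Wigner ensemble with band width $\beta_N$ is defined by $X_N(i,j)=\tilde X_N(i,j)$ if $|i-j|\le b_N$ and $X_N(i,j)=0$ otherwise; the periodic band matrix ensemble with band width $\beta_N$ is defined by $X_N(i,j)=\tilde X_N(i,j)$ if $\min\{|i-j|,N-|i-j|\}\le b_N$ and $X_N(i,j)=0$ otherwise. **Theorem.** Let $X_N$ be a banded Wigner ensemble or a periodic band matrix ensemble with band width $\beta_N$, and assume that all moments of the entries exist, i.e. $\mathbb E(|X_N(i,j)|^k)<\infty$ for all $k\in\mathbb N$. If there are constants $C>0$ and $\gamma>0$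 such that $\beta_N\ge C\,N^{\gamma}$ for all $N\ge1$, then $$\limsup_{N\to\infty}\Big\|\frac{1}{\sqrt{\beta_N}}\,X_N\Big\|\le 2\qquad \mathbb P\text{-almost surely},$$ where $\|\cdot\|$ is the operator norm on Euclidean space $\mathbb R^N$, i.e. the largest absolute value of an eigenvalue. -/

import Mathlib

open MeasureTheory ProbabilityTheory Filter

namespace BandMatrix

/-- A real symmetric matrix ensemble: for every `N` a random symmetric `N × N` matrix `X N`, whose
entries are real random variables on `Ω`. -/
structure IsMatrixEnsemble {Ω : Type*} [MeasurableSpace Ω]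
    (X : ∀ N : ℕ, Ω → Matrix (Fin N) (Fin N) ℝ) : Prop where
  measurable : ∀ (N : ℕ) (i j : Fin N), Measurable (fun ω => X N ω i j)
  symm : ∀ (N : ℕ) (i j : Fin N) (ω : Ω), X N ω i j = X N ω j i

/-- A Wigner ensemble: a symmetric matrix ensemble such that, for each `N`, the entries on and above
the diagonal are independent, all entries (for all `N`) have the same distribution, and the entries
have mean `0` and second moment `1`. No relation is imposed between the matrices for different
values of `N`, beyond the common distribution of their entries. -/
structure IsWignerEnsemble {Ω : Type*} [MeasurableSpace Ω] (P : Measure Ω)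
    (X : ∀ N : ℕ, Ω → Matrix (Fin N) (Fin N) ℝ) : Prop extends IsMatrixEnsemble X where
  indep : ∀ N : ℕ,
    iIndepFun (fun (p : {p : Fin N × Fin N // p.1 ≤ p.2}) (ω : Ω) => X N ω p.1.1 p.1.2) P
  identDistrib : ∀ (N M : ℕ) (i j : Fin N) (k l : Fin M),
    IdentDistrib (fun ω => X N ω i j) (fun ω => X M ω k l) P P
  mean_zero : ∀ (N : ℕ) (i j : Fin N), ∫ ω, X N ω i j ∂P = 0
  second_moment : ∀ (N : ℕ) (i j : Fin N), ∫ ω, (X N ω i j) ^ 2 ∂P = 1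

/-- All moments of all entries exist. -/
def AllMomentsExist {Ω : Type*} [MeasurableSpace Ω] (P : Measure Ω)
    (X : ∀ N : ℕ, Ω → Matrix (Fin N) (Fin N) ℝ) : Prop :=
  ∀ (N : ℕ) (i j : Fin N) (k : ℕ), Integrable (fun ω => |X N ω i j| ^ k) P

/-- The band width `β_N = 2 b_N + 1`. -/
def bandWidth (b : ℕ → ℕ) (N : ℕ) : ℕ := 2 * b N + 1

/-- The standing assumptions on the half-widths `b_N`: they tend to infinity, and the band width
is at most `N` for every `N ≥ 1`. -/
def IsHalfWidth (b : ℕ → ℕ) : Prop :=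
  Tendsto b atTop atTop ∧ ∀ N : ℕ, 1 ≤ N → bandWidth b N ≤ N

/-- The modulus `min (|k|, N - |k|)` for `|k| ≤ N`; for `k = i - j` with indices `i, j` this is the
distance of `i` and `j` in `ℤ / N ℤ`. -/
def cyclicAbs (N : ℕ) (k : ℤ) : ℤ :=
  min (abs k) (abs ((N : ℤ) - abs k))

/-- A banded Wigner ensemble: the entries of a Wigner ensemble with `|i - j| ≤ b_N` are kept, the
others are replaced by zero. -/
def IsBandedWigner {Ω : Type*} [MeasurableSpace Ω] (P : Measure Ω) (b : ℕ → ℕ)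
    (X : ∀ N : ℕ, Ω → Matrix (Fin N) (Fin N) ℝ) : Prop :=
  IsHalfWidth b ∧ ∃ Y : ∀ N : ℕ, Ω → Matrix (Fin N) (Fin N) ℝ, IsWignerEnsemble P Y ∧
    ∀ (N : ℕ) (ω : Ω) (i j : Fin N),
      X N ω i j = if |((i : ℕ) : ℤ) - ((j : ℕ) : ℤ)| ≤ (b N : ℤ) then Y N ω i j else 0

/-- A periodic band matrix ensemble: the entries of a Wigner ensemble at cyclic distance at most
`b_N` from the diagonal are kept, the others are replaced by zero. -/
def IsPeriodicBandedWigner {Ω : Type*} [MeasurableSpace Ω] (P : Measure Ω) (b : ℕ → ℕ)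
    (X : ∀ N : ℕ, Ω → Matrix (Fin N) (Fin N) ℝ) : Prop :=
  IsHalfWidth b ∧ ∃ Y : ∀ N : ℕ, Ω → Matrix (Fin N) (Fin N) ℝ, IsWignerEnsemble P Y ∧
    ∀ (N : ℕ) (ω : Ω) (i j : Fin N),
      X N ω i j =
        if cyclicAbs N (((i : ℕ) : ℤ) - ((j : ℕ) : ℤ)) ≤ (b N : ℤ) then Y N ω i j else 0

/-- The norm of a matrix as an operator on the Euclidean space `ℝ^N`. -/
noncomputable def opNorm {N : ℕ} (M : Matrix (Fin N) (Fin N) ℝ) : ℝ :=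
  ‖Matrix.toEuclideanCLM (n := Fin N) (𝕜 := ℝ) M‖

end BandMatrix

/-! This is the moment method, and the band shape enters only through the symmetric support with at
most `β` positions per row. Entries are truncated at a level `l` of order `β ^ (1/8)` and recentred.
The expected trace of a power of order `l` is a sum over closed walks. By independence and centring,
a walk that uses some edge exactly once contributes zero.

Walks are not sorted by shape. Instead `walkBound` weighs each partial walk so that summing over the
next step is controlled (`sum_walkBound_addEdge_le`). With `q = √β`, a step to a fresh vertex has at
most `q ^ 2` choices of weight `1 / q`, and closing an open edge has total weight `q`. These two
options give the constant 2. Every other step leads to a vertex already visited, and its relative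
cost vanishes because `l ^ 3 / q` tends to 0. The power of `L` in `walkBound` pays for the choice
among several open edges.

Hence the expected trace of the `r`-th power is at most `N * (ρ * q) ^ r` with `ρ` near 2
(`integral_trace_edgeMatrix_pow_le`). Markov's inequality at `σ > ρ` gives the tail `N * (ρ / σ) ^
(2 * p)`, which is summable since `p` grows at least like a power of `N`. High moments control the
truncation error (`measureReal_lt_opNorm_edgeMatrix_le`), and Borel–Cantelli concludes. -/

namespace BandMatrix

/-! ### Combinatorics of walks: potential and one-step bound -/

section Walks

variable {V : Type*} [DecidableEq V]

/-- The edge multiplicities after one further step along `e`. -/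
def addEdge (m : Sym2 V → ℕ) (e : Sym2 V) : Sym2 V → ℕ := Function.update m e (m e + 1)

lemma addEdge_self (m : Sym2 V → ℕ) (e : Sym2 V) : addEdge m e e = m e + 1 := by
  simp [addEdge]

lemma addEdge_of_ne (m : Sym2 V → ℕ) {e f : Sym2 V} (h : f ≠ e) : addEdge m e f = m f := by
  simp [addEdge, h]

variable [Fintype V]

/-- The number of edges at `v` that have multiplicity exactly one. -/
def openDeg (m : Sym2 V → ℕ) (v : V) : ℕ := (Finset.univ.filter fun w => m s(v, w) = 1).card

/-- The number of edges with multiplicity exactly one. -/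
def openCount (m : Sym2 V → ℕ) : ℕ := (Finset.univ.filter fun e => m e = 1).card

/-- The total surplus of the open degrees over those of a path that ends at `u`. It bounds the
number of future steps along an open edge that are not forced. -/
def potential (m : Sym2 V → ℕ) (u : V) : ℕ := ∑ v, (openDeg m v - if v = u then 1 else 2)

/-- The total multiplicity in excess of two. -/
def surplus (m : Sym2 V → ℕ) : ℕ := ∑ e, (m e - 2)

/-- The vertices visited so far by a walk with current vertex `u` and edge multiplicities `m`. -/
def touched (m : Sym2 V → ℕ) (u : V) : Finset V :=
  Finset.univ.filter fun v => v = u ∨ ∃ w, m s(v, w) ≠ 0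

lemma openDeg_addEdge_of_ne (m : Sym2 V → ℕ) {u w v : V} (hu : v ≠ u) (hw : v ≠ w) :
    openDeg (addEdge m s(u, w)) v = openDeg m v := by
  unfold openDeg
  congr 1
  refine Finset.filter_congr fun z _ => ?_
  rw [addEdge_of_ne]
  simp only [ne_eq, Sym2.eq_iff]
  tauto

lemma openDeg_addEdge_left_zero (m : Sym2 V → ℕ) {u w : V} (h : m s(u, w) = 0) :
    openDeg (addEdge m s(u, w)) u = openDeg m u + 1 := by
  unfold openDeg
  rw [← Finset.card_insert_of_notMem (a := w) (by simp [h])]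
  congr 1
  ext z
  by_cases hz : z = w
  · subst hz; simp [addEdge_self, h]
  · have : s(u, z) ≠ s(u, w) := fun h => hz (Sym2.congr_right.1 h)
    simp [addEdge_of_ne m this, hz]

lemma openDeg_addEdge_left_one (m : Sym2 V → ℕ) {u w : V} (h : m s(u, w) = 1) :
    openDeg (addEdge m s(u, w)) u + 1 = openDeg m u := by
  unfold openDeg
  rw [← Finset.card_insert_of_notMem (a := w) (by simp [addEdge_self, h])]
  congr 1
  ext z
  by_cases hz : z = w
  · subst hz; simp [addEdge_self, h]
  · have : s(u, z) ≠ s(u, w) := fun h => hz (Sym2.congr_right.1 h)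
    simp [addEdge_of_ne m this, hz]

lemma openDeg_addEdge_of_two_le (m : Sym2 V → ℕ) {e : Sym2 V} (h : 2 ≤ m e) (v : V) :
    openDeg (addEdge m e) v = openDeg m v := by
  unfold openDeg
  congr 1
  refine Finset.filter_congr fun z _ => ?_
  by_cases hz : s(v, z) = e
  · subst hz; rw [addEdge_self]; omega
  · rw [addEdge_of_ne m hz]

lemma openDeg_addEdge_right_zero (m : Sym2 V → ℕ) {u w : V} (h : m s(u, w) = 0) :
    openDeg (addEdge m s(u, w)) w = openDeg m w + 1 := by
  rw [Sym2.eq_swap] at h ⊢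
  exact openDeg_addEdge_left_zero m h

lemma openDeg_addEdge_right_one (m : Sym2 V → ℕ) {u w : V} (h : m s(u, w) = 1) :
    openDeg (addEdge m s(u, w)) w + 1 = openDeg m w := by
  rw [Sym2.eq_swap] at h ⊢
  exact openDeg_addEdge_left_one m h

lemma openCount_addEdge_zero (m : Sym2 V → ℕ) {e : Sym2 V} (h : m e = 0) :
    openCount (addEdge m e) = openCount m + 1 := by
  unfold openCount
  rw [← Finset.card_insert_of_notMem (a := e) (by simp [h])]
  congr 1
  ext z
  by_cases hz : z = e
  · subst hz; simp [addEdge_self, h]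
  · simp [addEdge_of_ne m hz, hz]

lemma openCount_addEdge_one (m : Sym2 V → ℕ) {e : Sym2 V} (h : m e = 1) :
    openCount (addEdge m e) + 1 = openCount m := by
  unfold openCount
  rw [← Finset.card_insert_of_notMem (a := e) (by simp [addEdge_self, h])]
  congr 1
  ext z
  by_cases hz : z = e
  · subst hz; simp [addEdge_self, h]
  · simp [addEdge_of_ne m hz, hz]

lemma openCount_addEdge_of_two_le (m : Sym2 V → ℕ) {e : Sym2 V} (h : 2 ≤ m e) :
    openCount (addEdge m e) = openCount m := by
  unfold openCount
  congr 1
  refine Finset.filter_congr fun z _ => ?_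
  by_cases hz : z = e
  · subst hz; rw [addEdge_self]; omega
  · rw [addEdge_of_ne m hz]

lemma surplus_addEdge (m : Sym2 V → ℕ) (e : Sym2 V) :
    surplus (addEdge m e) = surplus m + if 2 ≤ m e then 1 else 0 := by
  unfold surplus
  rw [← Finset.add_sum_erase _ _ (Finset.mem_univ e),
    ← Finset.add_sum_erase _ (fun e => m e - 2) (Finset.mem_univ e),
    Finset.sum_congr rfl fun f hf => by rw [addEdge_of_ne m (Finset.ne_of_mem_erase hf)],
    addEdge_self]
  split_ifs <;> omega

lemma card_touched_addEdge_le (m : Sym2 V → ℕ) (u w : V) :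
    (touched (addEdge m s(u, w)) w).card ≤ (touched m u).card + 1 := by
  refine (Finset.card_le_card (t := insert w (touched m u)) ?_).trans (Finset.card_insert_le _ _)
  intro v hv
  simp only [touched, Finset.mem_filter, Finset.mem_univ, true_and, Finset.mem_insert] at hv ⊢
  rcases hv with rfl | ⟨z, hz⟩
  · exact Or.inl rfl
  · by_cases h : s(v, z) = s(u, w)
    · rw [Sym2.eq_iff] at h
      tauto
    · rw [addEdge_of_ne m h] at hz
      exact Or.inr (Or.inr ⟨z, hz⟩)

lemma openDeg_eq_zero_of_notMem_touched {m : Sym2 V → ℕ} {u w : V} (h : w ∉ touched m u) :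
    openDeg m w = 0 := by
  simp only [touched, Finset.mem_filter, Finset.mem_univ, true_and, not_or, not_exists,
    not_not] at h
  simp [openDeg, h.2]

lemma openDeg_le_card_touched (m : Sym2 V → ℕ) (u : V) :
    openDeg m u ≤ (touched m u).card := by
  refine Finset.card_le_card fun w hw => ?_
  simp only [touched, Finset.mem_filter, Finset.mem_univ, true_and] at hw ⊢
  exact Or.inr ⟨u, by rw [Sym2.eq_swap, hw]; simp⟩

lemma mem_touched_of_ne_zero {m : Sym2 V → ℕ} {u w : V} (h : m s(u, w) ≠ 0) :
    w ∈ touched m u := by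
  simp only [touched, Finset.mem_filter, Finset.mem_univ, true_and]
  exact Or.inr ⟨u, by rwa [Sym2.eq_swap]⟩

/-- A step changes open degrees and allowances only at its two ends, so the remaining vertices
contribute a common `R`. The estimates below then reduce to truncated arithmetic at `u` and `w`. -/
lemma exists_potential_eq {u w : V} (huw : u ≠ w) (m : Sym2 V → ℕ) : ∃ R : ℕ,
    potential m u = (openDeg m u - 1) + (openDeg m w - 2) + R ∧
    potential (addEdge m s(u, w)) w =
      (openDeg (addEdge m s(u, w)) u - 2) + (openDeg (addEdge m s(u, w)) w - 1) + R := by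
  refine ⟨∑ v ∈ (Finset.univ.erase u).erase w, (openDeg m v - 2), ?_, ?_⟩
  · unfold potential
    rw [← Finset.add_sum_erase _ _ (Finset.mem_univ u),
      ← Finset.add_sum_erase _ _ (Finset.mem_erase.2 ⟨huw.symm, Finset.mem_univ w⟩),
      if_pos rfl, if_neg huw.symm, ← add_assoc]
    congr 1
    refine Finset.sum_congr rfl fun v hv => ?_
    rw [if_neg (by simp at hv; tauto)]
  · unfold potential
    rw [← Finset.add_sum_erase _ _ (Finset.mem_univ u),
      ← Finset.add_sum_erase _ _ (Finset.mem_erase.2 ⟨huw.symm, Finset.mem_univ w⟩),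
      if_pos rfl, if_neg huw, ← add_assoc]
    congr 1
    refine Finset.sum_congr rfl fun v hv => ?_
    simp only [Finset.mem_erase, Finset.mem_univ, and_true] at hv
    rw [if_neg hv.1, openDeg_addEdge_of_ne m hv.2 hv.1]

lemma exists_potential_eq_loop (u : V) (m : Sym2 V → ℕ) : ∃ R : ℕ,
    potential m u = (openDeg m u - 1) + R ∧
    potential (addEdge m s(u, u)) u = (openDeg (addEdge m s(u, u)) u - 1) + R := by
  refine ⟨∑ v ∈ Finset.univ.erase u, (openDeg m v - 2), ?_, ?_⟩
  · unfold potential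
    rw [← Finset.add_sum_erase _ _ (Finset.mem_univ u), if_pos rfl]
    congr 1
    refine Finset.sum_congr rfl fun v hv => ?_
    rw [if_neg (Finset.ne_of_mem_erase hv)]
  · unfold potential
    rw [← Finset.add_sum_erase _ _ (Finset.mem_univ u), if_pos rfl]
    congr 1
    refine Finset.sum_congr rfl fun v hv => ?_
    have := Finset.ne_of_mem_erase hv
    rw [if_neg this, openDeg_addEdge_of_ne m this this]

/-- The extra open edge at `u` is offset by its allowance rising from 1 to 2. The new endpoint has
open degree 1, which is its allowance. -/
lemma potential_addEdge_new {m : Sym2 V → ℕ} {u w : V} (hw : w ∉ touched m u) :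
    potential (addEdge m s(u, w)) w ≤ potential m u := by
  have h0 : m s(u, w) = 0 := by
    by_contra h
    exact hw (mem_touched_of_ne_zero h)
  have huw : u ≠ w := by
    rintro rfl
    exact hw (by simp [touched])
  obtain ⟨R, h1, h2⟩ := exists_potential_eq huw m
  have h3 := openDeg_addEdge_left_zero m h0
  have h4 := openDeg_addEdge_right_zero m h0
  have h5 := openDeg_eq_zero_of_notMem_touched hw
  omega

lemma potential_addEdge_zero {m : Sym2 V → ℕ} {u w : V} (h0 : m s(u, w) = 0) :
    potential (addEdge m s(u, w)) w ≤ potential m u + 2 := by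
  by_cases huw : u = w
  · subst huw
    obtain ⟨R, h1, h2⟩ := exists_potential_eq_loop u m
    have h3 := openDeg_addEdge_left_zero m h0
    omega
  obtain ⟨R, h1, h2⟩ := exists_potential_eq huw m
  have h3 := openDeg_addEdge_left_zero m h0
  have h4 := openDeg_addEdge_right_zero m h0
  omega

/-- The strict drop occurs exactly when the walk has a choice of open edge at `u`. It will pay a
factor `L` for that choice. -/
lemma potential_addEdge_one {m : Sym2 V → ℕ} {u w : V} (h0 : m s(u, w) = 1) :
    potential (addEdge m s(u, w)) w ≤ potential m u ∧
      (2 ≤ openDeg m u → potential (addEdge m s(u, w)) w + 1 ≤ potential m u) := by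
  by_cases huw : u = w
  · subst huw
    obtain ⟨R, h1, h2⟩ := exists_potential_eq_loop u m
    have h3 := openDeg_addEdge_left_one m h0
    omega
  obtain ⟨R, h1, h2⟩ := exists_potential_eq huw m
  have h3 := openDeg_addEdge_left_one m h0
  have h4 := openDeg_addEdge_right_one m h0
  omega

lemma potential_addEdge_of_two_le {m : Sym2 V → ℕ} {u w : V} (h0 : 2 ≤ m s(u, w)) :
    potential (addEdge m s(u, w)) w ≤ potential m u + 1 := by
  by_cases huw : u = w
  · subst huw
    obtain ⟨R, h1, h2⟩ := exists_potential_eq_loop u m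
    have h3 := openDeg_addEdge_of_two_le m h0 u
    omega
  obtain ⟨R, h1, h2⟩ := exists_potential_eq huw m
  have h3 := openDeg_addEdge_of_two_le m h0 u
  have h4 := openDeg_addEdge_of_two_le m h0 w
  omega

/-- The bound on the contribution of all walks of `r` steps that start at `u`, after a past with
edge multiplicities `m`. -/
noncomputable def walkBound (K L q ρ : ℝ) (r : ℕ) (m : Sym2 V → ℕ) (u : V) : ℝ :=
  K ^ surplus m * L ^ potential m u * (ρ * q) ^ r / q ^ openCount m

/-- The three summands pay for closing an open edge, for opening an edge to a fresh vertex, and for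
the rare steps: opening an edge to a visited vertex (potential up by at most 2) or reusing an edge
already traversed twice (surplus up by 1, potential by at most 1). -/
lemma walkBound_addEdge_le {K L q ρ : ℝ} (hK : 0 ≤ K) (hL : 1 ≤ L) (hq : 0 < q) (hρ : 0 ≤ ρ)
    (r : ℕ) {m : Sym2 V → ℕ} {u : V} (hu : ((touched m u).card : ℝ) ≤ L) (w : V) :
    walkBound K L q ρ r (addEdge m s(u, w)) w ≤
      walkBound K L q ρ r m u *
        ((if m s(u, w) = 1 then q / openDeg m u else 0) + 1 / q +
          if w ∈ touched m u then L ^ 2 / q + K * L else 0) := by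
  have hL0 : 0 ≤ L := by linarith
  have hZ : 0 ≤ K ^ surplus m * (ρ * q) ^ r / q ^ openCount m := by positivity
  have hW : walkBound K L q ρ r m u =
      K ^ surplus m * (ρ * q) ^ r / q ^ openCount m * L ^ potential m u := by
    unfold walkBound; ring
  have hn : 0 ≤ (if w ∈ touched m u then L ^ 2 / q + K * L else 0) := by
    split_ifs <;> positivity
  have hW0 : 0 ≤ walkBound K L q ρ r m u := by unfold walkBound; positivity
  rcases Nat.lt_trichotomy (m s(u, w)) 1 with h | h | h
  · have h0 : m s(u, w) = 0 := by omega
    have h1 : walkBound K L q ρ r (addEdge m s(u, w)) w =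
        K ^ surplus m * (ρ * q) ^ r / q ^ openCount m *
          (L ^ potential (addEdge m s(u, w)) w * (1 / q)) := by
      unfold walkBound
      rw [surplus_addEdge, if_neg (by omega), openCount_addEdge_zero m h0, pow_succ, add_zero]
      field_simp
    rw [h1, if_neg (by omega), zero_add]
    by_cases hw : w ∈ touched m u
    · rw [if_pos hw, hW, mul_assoc]
      refine mul_le_mul_of_nonneg_left ?_ hZ
      have : L ^ potential (addEdge m s(u, w)) w ≤ L ^ potential m u * L ^ 2 := by
        rw [← pow_add]
        exact pow_le_pow_right₀ hL (potential_addEdge_zero h0)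
      calc L ^ potential (addEdge m s(u, w)) w * (1 / q)
          ≤ L ^ potential m u * L ^ 2 * (1 / q) := by gcongr
        _ = L ^ potential m u * (L ^ 2 / q) := by ring
        _ ≤ _ := by
          refine mul_le_mul_of_nonneg_left ?_ (by positivity)
          have : 0 ≤ 1 / q := by positivity
          have : 0 ≤ K * L := by positivity
          linarith
    · rw [if_neg hw, hW, mul_assoc, add_zero]
      refine mul_le_mul_of_nonneg_left ?_ hZ
      have := pow_le_pow_right₀ hL (potential_addEdge_new hw)
      gcongr
  · rw [if_pos h]
    have hd : 1 ≤ openDeg m u := by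
      have := openDeg_addEdge_left_one m h
      omega
    have hd' : (0 : ℝ) < openDeg m u := by exact_mod_cast hd
    have h1 : walkBound K L q ρ r (addEdge m s(u, w)) w =
        K ^ surplus m * (ρ * q) ^ r / q ^ openCount m *
          (L ^ potential (addEdge m s(u, w)) w * q) := by
      unfold walkBound
      rw [surplus_addEdge, if_neg (by omega), ← openCount_addEdge_one m h, pow_succ, add_zero]
      field_simp
    -- A single open edge is a forced choice. Otherwise there are at most `L` candidates, and the
    -- potential drops.
    have h2 : L ^ potential (addEdge m s(u, w)) w * openDeg m u ≤ L ^ potential m u := by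
      obtain ⟨h3, h4⟩ := potential_addEdge_one h
      by_cases h5 : 2 ≤ openDeg m u
      · calc L ^ potential (addEdge m s(u, w)) w * openDeg m u
            ≤ L ^ potential (addEdge m s(u, w)) w * L := by
              gcongr
              exact le_trans (by exact_mod_cast openDeg_le_card_touched m u) hu
          _ = L ^ (potential (addEdge m s(u, w)) w + 1) := by rw [pow_succ]
          _ ≤ _ := pow_le_pow_right₀ hL (h4 h5)
      · have : openDeg m u = 1 := by omega
        rw [this, Nat.cast_one, mul_one]
        exact pow_le_pow_right₀ hL h3
    calc walkBound K L q ρ r (addEdge m s(u, w)) w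
        = K ^ surplus m * (ρ * q) ^ r / q ^ openCount m *
          ((L ^ potential (addEdge m s(u, w)) w * openDeg m u) * (q / openDeg m u)) := by
          rw [h1]; field_simp
      _ ≤ K ^ surplus m * (ρ * q) ^ r / q ^ openCount m *
          (L ^ potential m u * (q / openDeg m u)) := by gcongr
      _ = walkBound K L q ρ r m u * (q / openDeg m u) := by rw [hW]; ring
      _ ≤ _ := by
        refine mul_le_mul_of_nonneg_left ?_ hW0
        have : 0 ≤ 1 / q := by positivity
        linarith
  · have h2 : 2 ≤ m s(u, w) := h
    have h1 : walkBound K L q ρ r (addEdge m s(u, w)) w =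
        K ^ surplus m * (ρ * q) ^ r / q ^ openCount m *
          (L ^ potential (addEdge m s(u, w)) w * K) := by
      unfold walkBound
      rw [surplus_addEdge, if_pos h2, openCount_addEdge_of_two_le m h2, pow_succ]
      ring
    have h3 : L ^ potential (addEdge m s(u, w)) w ≤ L ^ potential m u * L := by
      rw [← pow_succ]
      exact pow_le_pow_right₀ hL (potential_addEdge_of_two_le h2)
    rw [h1, if_neg (by omega), zero_add, if_pos (mem_touched_of_ne_zero (by omega)), hW, mul_assoc]
    refine mul_le_mul_of_nonneg_left ?_ hZ
    calc L ^ potential (addEdge m s(u, w)) w * K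
        ≤ L ^ potential m u * L * K := by gcongr
      _ = L ^ potential m u * (K * L) := by ring
      _ ≤ _ := by
        refine mul_le_mul_of_nonneg_left ?_ (by positivity)
        have : 0 ≤ 1 / q := by positivity
        have : 0 ≤ L ^ 2 / q := by positivity
        linarith

/-- Induction step of the trace bound. Closing and opening contribute `q` each, and at most `L`
visited vertices contribute the error terms in `ρ`. -/
lemma sum_walkBound_addEdge_le {K L q ρ : ℝ} (hK : 0 ≤ K) (hL : 1 ≤ L) (hq : 0 < q)
    (hρ : 2 + L ^ 3 / q ^ 2 + L ^ 2 * K / q ≤ ρ) {A : Finset V} (hA : (A.card : ℝ) ≤ q ^ 2)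
    (r : ℕ) {m : Sym2 V → ℕ} {u : V} (hu : ((touched m u).card : ℝ) ≤ L) :
    ∑ w ∈ A, walkBound K L q ρ r (addEdge m s(u, w)) w ≤ walkBound K L q ρ (r + 1) m u := by
  have hL0 : 0 ≤ L := by linarith
  have hρ0 : 0 ≤ ρ := le_trans (by positivity) hρ
  have hW0 : 0 ≤ walkBound K L q ρ r m u := by unfold walkBound; positivity
  have h1 : ∑ w ∈ A, (if m s(u, w) = 1 then q / openDeg m u else 0) ≤ q := by
    calc ∑ w ∈ A, (if m s(u, w) = 1 then q / (openDeg m u : ℝ) else 0)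
        ≤ ∑ w, (if m s(u, w) = 1 then q / (openDeg m u : ℝ) else 0) := by
          refine Finset.sum_le_sum_of_subset_of_nonneg (Finset.subset_univ _) fun w _ _ => ?_
          split_ifs <;> positivity
      _ = openDeg m u * (q / openDeg m u) := by
          rw [← Finset.sum_filter, Finset.sum_const, nsmul_eq_mul]; rfl
      _ ≤ q := by
          rcases Nat.eq_zero_or_pos (openDeg m u) with h | h
          · simp [h, hq.le]
          · have : (openDeg m u : ℝ) ≠ 0 := by exact_mod_cast h.ne'
            rw [mul_div_cancel₀ _ this]
  have h2 : ∑ w ∈ A, (1 / q) ≤ q := by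
    rw [Finset.sum_const, nsmul_eq_mul, mul_one_div, div_le_iff₀ hq]
    nlinarith
  have h3 : ∑ w ∈ A, (if w ∈ touched m u then L ^ 2 / q + K * L else 0) ≤
      L * (L ^ 2 / q + K * L) := by
    calc ∑ w ∈ A, (if w ∈ touched m u then L ^ 2 / q + K * L else 0)
        ≤ ∑ w, (if w ∈ touched m u then L ^ 2 / q + K * L else 0) := by
          refine Finset.sum_le_sum_of_subset_of_nonneg (Finset.subset_univ _) fun w _ _ => ?_
          split_ifs <;> positivity
      _ = (touched m u).card * (L ^ 2 / q + K * L) := by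
          rw [← Finset.sum_filter, Finset.sum_const, nsmul_eq_mul]; simp
      _ ≤ _ := by gcongr
  calc ∑ w ∈ A, walkBound K L q ρ r (addEdge m s(u, w)) w
      ≤ ∑ w ∈ A, walkBound K L q ρ r m u *
        ((if m s(u, w) = 1 then q / openDeg m u else 0) + 1 / q +
          if w ∈ touched m u then L ^ 2 / q + K * L else 0) :=
        Finset.sum_le_sum fun w _ => walkBound_addEdge_le hK hL hq hρ0 r hu w
    _ ≤ walkBound K L q ρ r m u * (q + q + L * (L ^ 2 / q + K * L)) := by
        rw [← Finset.mul_sum, Finset.sum_add_distrib, Finset.sum_add_distrib]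
        refine mul_le_mul_of_nonneg_left ?_ hW0
        linarith
    _ = walkBound K L q ρ r m u * ((2 + L ^ 3 / q ^ 2 + L ^ 2 * K / q) * q) := by
        congr 1; field_simp; ring
    _ ≤ walkBound K L q ρ r m u * (ρ * q) := by gcongr
    _ = walkBound K L q ρ (r + 1) m u := by
        unfold walkBound; rw [pow_succ]; ring

end Walks

/-! ### Expected traces of powers for bounded independent entries -/

section Expectation

variable {V : Type*} [Fintype V] {Ω : Type*}

section

variable [MeasurableSpace Ω] {P : Measure Ω} [IsProbabilityMeasure P] {x : Sym2 V → Ω → ℝ} {K : ℝ}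

lemma integrable_prod_pow (hx : ∀ e, Measurable (x e)) (hK : ∀ e ω, |x e ω| ≤ K)
    (m : Sym2 V → ℕ) : Integrable (fun ω => ∏ e, x e ω ^ m e) P := by
  refine Integrable.of_bound (C := ∏ e, K ^ m e)
    (Finset.measurable_fun_prod _ fun e _ => (hx e).pow_const _).aestronglyMeasurable
    (Eventually.of_forall fun ω => ?_)
  rw [Real.norm_eq_abs, Finset.abs_prod]
  refine Finset.prod_le_prod (fun _ _ => abs_nonneg _) fun e _ => ?_
  rw [abs_pow]
  exact pow_le_pow_left₀ (abs_nonneg _) (hK e ω) _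

/-- Two factors use the second moment and each of the others costs `K`, so only multiplicity in
excess of two is charged. -/
lemma abs_integral_pow_le {X : Ω → ℝ} (hX : Measurable X) (hK : ∀ ω, |X ω| ≤ K)
    (h2 : ∫ ω, X ω ^ 2 ∂P ≤ 1) (n : ℕ) :
    |∫ ω, X ω ^ (n + 2) ∂P| ≤ K ^ n := by
  have hint : Integrable (fun ω => X ω ^ 2) P :=
    Integrable.of_bound (C := K ^ 2) (hX.pow_const 2).aestronglyMeasurable
      (Eventually.of_forall fun ω => by
        rw [Real.norm_eq_abs, abs_pow]
        exact pow_le_pow_left₀ (abs_nonneg _) (hK ω) _)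
  obtain ⟨ω₀⟩ : Nonempty Ω := P.nonempty_of_neZero
  have hK0 : 0 ≤ K := (abs_nonneg _).trans (hK ω₀)
  calc |∫ ω, X ω ^ (n + 2) ∂P| ≤ ∫ ω, K ^ n * X ω ^ 2 ∂P := by
        rw [← Real.norm_eq_abs]
        refine norm_integral_le_of_norm_le (hint.const_mul _) (Eventually.of_forall fun ω => ?_)
        rw [Real.norm_eq_abs, pow_add, abs_mul, abs_pow, abs_of_nonneg (sq_nonneg (X ω))]
        exact mul_le_mul_of_nonneg_right (pow_le_pow_left₀ (abs_nonneg _) (hK ω) _) (sq_nonneg _)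
    _ = K ^ n * ∫ ω, X ω ^ 2 ∂P := integral_const_mul _ _
    _ ≤ K ^ n := mul_le_of_le_one_right (by positivity) h2

lemma abs_integral_prod_pow_le (hx : ∀ e, Measurable (x e)) (hK : ∀ e ω, |x e ω| ≤ K)
    (hind : iIndepFun x P) (h1 : ∀ e, ∫ ω, x e ω ∂P = 0) (h2 : ∀ e, ∫ ω, x e ω ^ 2 ∂P ≤ 1)
    (m : Sym2 V → ℕ) :
    |∫ ω, ∏ e, x e ω ^ m e ∂P| ≤ if openCount m = 0 then K ^ surplus m else 0 := by
  have hprod : ∫ ω, ∏ e, x e ω ^ m e ∂P = ∏ e, ∫ ω, x e ω ^ m e ∂P :=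
    (hind.comp (fun e t => t ^ m e) fun e => measurable_id.pow_const _)
      |>.integral_fun_prod_eq_prod_integral fun e => ((hx e).pow_const _).aestronglyMeasurable
  rw [hprod, Finset.abs_prod]
  by_cases h : openCount m = 0
  · rw [if_pos h, surplus, ← Finset.prod_pow_eq_pow_sum]
    refine Finset.prod_le_prod (fun _ _ => abs_nonneg _) fun e _ => ?_
    have he : m e ≠ 1 := by
      rw [openCount, Finset.card_eq_zero, Finset.filter_eq_empty_iff] at h
      exact h (Finset.mem_univ e)
    by_cases he0 : m e = 0
    · simp [he0]
    · obtain ⟨n, hn⟩ : ∃ n, m e = n + 2 := ⟨m e - 2, by omega⟩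
      rw [hn, Nat.add_sub_cancel]
      exact abs_integral_pow_le (hx e) (hK e) (h2 e) n
  · rw [if_neg h]
    obtain ⟨e, he⟩ := Finset.card_ne_zero.1 h
    rw [Finset.prod_eq_zero (Finset.mem_univ e)]
    simp only [Finset.mem_filter] at he
    simp [he.2, h1]

end

variable [DecidableEq V]

/-- The symmetric matrix with entries `x s(u, w)` on the pairs with `w ∈ A u`. -/
def edgeMatrix (A : V → Finset V) (x : Sym2 V → Ω → ℝ) (ω : Ω) : Matrix V V ℝ :=
  Matrix.of fun u w => if w ∈ A u then x s(u, w) ω else 0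

lemma prod_pow_addEdge (a : Sym2 V → ℝ) (m : Sym2 V → ℕ) (e : Sym2 V) :
    ∏ f, a f ^ addEdge m e f = (∏ f, a f ^ m f) * a e := by
  rw [← Finset.mul_prod_erase _ _ (Finset.mem_univ e),
    ← Finset.mul_prod_erase _ (fun f => a f ^ m f) (Finset.mem_univ e),
    Finset.prod_congr rfl fun f hf => by rw [addEdge_of_ne m (Finset.ne_of_mem_erase hf)],
    addEdge_self, pow_succ]
  ring

/-- The walk takes one step: the first matrix factor is absorbed into the monomial recording the
past. This recursion drives both inductions below. -/
lemma prod_pow_mul_edgeMatrix_pow_succ (A : V → Finset V) (x : Sym2 V → Ω → ℝ) (ω : Ω)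
    (m : Sym2 V → ℕ) (r : ℕ) (u v : V) :
    (∏ e, x e ω ^ m e) * (edgeMatrix A x ω ^ (r + 1)) u v =
      ∑ w ∈ A u, (∏ e, x e ω ^ addEdge m s(u, w) e) * (edgeMatrix A x ω ^ r) w v := by
  rw [pow_succ', Matrix.mul_apply, Finset.mul_sum]
  rw [← Finset.sum_filter_add_sum_filter_not _ (fun w => w ∈ A u), Finset.filter_mem_eq_inter,
    Finset.univ_inter]
  rw [Finset.sum_eq_zero (s := Finset.filter (fun w => w ∉ A u) Finset.univ), add_zero]
  · refine Finset.sum_congr rfl fun w hw => ?_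
    rw [prod_pow_addEdge (fun e => x e ω)]
    simp only [edgeMatrix, Matrix.of_apply, if_pos hw]
    ring
  · intro w hw
    simp only [Finset.mem_filter, Finset.mem_univ, true_and] at hw
    simp [edgeMatrix, hw]

variable [MeasurableSpace Ω] {P : Measure Ω} [IsProbabilityMeasure P] {x : Sym2 V → Ω → ℝ} {K : ℝ}

lemma integrable_prod_pow_mul (hx : ∀ e, Measurable (x e)) (hK : ∀ e ω, |x e ω| ≤ K)
    (A : V → Finset V) (r : ℕ) (m : Sym2 V → ℕ) (u v : V) :
    Integrable (fun ω => (∏ e, x e ω ^ m e) * (edgeMatrix A x ω ^ r) u v) P := by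
  induction r generalizing m u with
  | zero => simpa using (integrable_prod_pow hx hK m).mul_const _
  | succ r ih =>
    simp_rw [prod_pow_mul_edgeMatrix_pow_succ]
    exact integrable_finsetSum _ fun w _ => ih _ _

lemma abs_integral_prod_pow_mul_le (hx : ∀ e, Measurable (x e)) (hK : ∀ e ω, |x e ω| ≤ K)
    (hind : iIndepFun x P) (h1 : ∀ e, ∫ ω, x e ω ∂P = 0) (h2 : ∀ e, ∫ ω, x e ω ^ 2 ∂P ≤ 1)
    {A : V → Finset V} {L q ρ : ℝ} (hK0 : 0 ≤ K) (hL : 1 ≤ L) (hq : 0 < q)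
    (hρ : 2 + L ^ 3 / q ^ 2 + L ^ 2 * K / q ≤ ρ) (hA : ∀ u, ((A u).card : ℝ) ≤ q ^ 2)
    (r : ℕ) (m : Sym2 V → ℕ) (u v : V) (hr : ((touched m u).card + r : ℝ) ≤ L) :
    |∫ ω, (∏ e, x e ω ^ m e) * (edgeMatrix A x ω ^ r) u v ∂P| ≤ walkBound K L q ρ r m u := by
  induction r generalizing m u with
  | zero =>
    -- Only completed walks without open edges survive, and there `walkBound` loses just `L ^
    -- potential m u ≥ 1`.
    have hW : (if openCount m = 0 then K ^ surplus m else 0) ≤ walkBound K L q ρ 0 m u := by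
      unfold walkBound
      split_ifs with h
      · rw [h, pow_zero, pow_zero, mul_one, div_one]
        exact le_mul_of_one_le_right (by positivity) (one_le_pow₀ hL)
      · have : 0 ≤ L := by linarith
        positivity
    refine le_trans ?_ hW
    have h0 : ∀ ω, edgeMatrix A x ω ^ 0 = 1 := fun ω => pow_zero _
    simp only [h0]
    rw [integral_mul_const, abs_mul]
    refine le_trans ?_ (abs_integral_prod_pow_le hx hK hind h1 h2 m)
    refine mul_le_of_le_one_right (abs_nonneg _) ?_
    rw [Matrix.one_apply]
    split_ifs <;> simp
  | succ r ih =>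
    have hr' : (touched m u).card + (r + 1 : ℝ) ≤ L := by exact_mod_cast hr
    simp_rw [prod_pow_mul_edgeMatrix_pow_succ]
    rw [integral_finsetSum _ fun w _ => integrable_prod_pow_mul hx hK A r _ w v]
    refine (Finset.abs_sum_le_sum_abs _ _).trans ?_
    have hr0 : (0 : ℝ) ≤ r := Nat.cast_nonneg r
    refine le_trans (Finset.sum_le_sum fun w _ => ih _ w ?_)
      (sum_walkBound_addEdge_le hK0 hL hq hρ (hA u) r (by linarith))
    have : ((touched (addEdge m s(u, w)) w).card : ℝ) ≤ (touched m u).card + 1 := by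
      exact_mod_cast card_touched_addEdge_le m u w
    linarith

theorem integral_trace_edgeMatrix_pow_le (hx : ∀ e, Measurable (x e)) (hK : ∀ e ω, |x e ω| ≤ K)
    (hind : iIndepFun x P) (h1 : ∀ e, ∫ ω, x e ω ∂P = 0) (h2 : ∀ e, ∫ ω, x e ω ^ 2 ∂P ≤ 1)
    {A : V → Finset V} {L q ρ : ℝ} (hK0 : 0 ≤ K) (hq : 0 < q)
    (hρ : 2 + L ^ 3 / q ^ 2 + L ^ 2 * K / q ≤ ρ) (hA : ∀ u, ((A u).card : ℝ) ≤ q ^ 2)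
    (r : ℕ) (hr : (1 + r : ℝ) ≤ L) :
    Integrable (fun ω => (edgeMatrix A x ω ^ r).trace) P ∧
    ∫ ω, (edgeMatrix A x ω ^ r).trace ∂P ≤ Fintype.card V * (ρ * q) ^ r := by
  have hint : ∀ u, Integrable (fun ω => (edgeMatrix A x ω ^ r) u u) P := fun u => by
    simpa using integrable_prod_pow_mul (P := P) hx hK A r 0 u u
  refine ⟨integrable_finsetSum _ fun u _ => hint u, ?_⟩
  simp only [Matrix.trace, Matrix.diag_apply]
  rw [integral_finsetSum _ fun u _ => hint u]
  have hr0 : (0 : ℝ) ≤ r := Nat.cast_nonneg r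
  have hterm : ∀ u ∈ Finset.univ, ∫ ω, (edgeMatrix A x ω ^ r) u u ∂P ≤ (ρ * q) ^ r := by
    intro u _
    have ht : touched (0 : Sym2 V → ℕ) u = {u} := by ext; simp [touched]
    have h := (le_abs_self _).trans (abs_integral_prod_pow_mul_le hx hK hind h1 h2 hK0
      (by linarith) hq hρ hA r 0 u u (by rw [ht]; simpa using hr))
    have hw : walkBound K L q ρ r (0 : Sym2 V → ℕ) u = (ρ * q) ^ r := by
      simp [walkBound, surplus, potential, openCount, openDeg]
    rw [hw] at h
    simpa using h
  refine (Finset.sum_le_sum hterm).trans_eq ?_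
  rw [Finset.sum_const, nsmul_eq_mul, Finset.card_univ]

end Expectation

/-! ### Operator norm and traces of even powers -/

section Norm

variable {N : ℕ}

lemma opNorm_add_le (M M' : Matrix (Fin N) (Fin N) ℝ) :
    opNorm (M + M') ≤ opNorm M + opNorm M' := by
  unfold opNorm
  rw [map_add]
  exact norm_add_le _ _

lemma opNorm_smul (c : ℝ) (M : Matrix (Fin N) (Fin N) ℝ) : opNorm (c • M) = |c| * opNorm M := by
  unfold opNorm
  rw [map_smul, norm_smul, Real.norm_eq_abs]

lemma norm_toEuclideanCLM_apply_le (M : Matrix (Fin N) (Fin N) ℝ)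
    (v : EuclideanSpace ℝ (Fin N)) :
    ‖Matrix.toEuclideanCLM (n := Fin N) (𝕜 := ℝ) M v‖ ^ 2 ≤
      (∑ i, ∑ j, M i j ^ 2) * ‖v‖ ^ 2 := by
  rw [EuclideanSpace.norm_sq_eq, EuclideanSpace.norm_sq_eq, Finset.sum_mul]
  refine Finset.sum_le_sum fun i _ => ?_
  simp only [Real.norm_eq_abs, sq_abs, Matrix.ofLp_toEuclideanCLM, Matrix.mulVec, dotProduct]
  exact Finset.sum_mul_sq_le_sq_mul_sq _ _ _

lemma opNorm_le_of_abs_le {M : Matrix (Fin N) (Fin N) ℝ} {a : ℝ} (ha : 0 ≤ a)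
    (h : ∀ i j, |M i j| ≤ a) : opNorm M ≤ N * a := by
  refine ContinuousLinearMap.opNorm_le_bound _ (by positivity) fun v => ?_
  refine abs_le_of_sq_le_sq' ?_ (by positivity) |>.2
  refine (norm_toEuclideanCLM_apply_le M v).trans ?_
  rw [mul_pow]
  refine mul_le_mul_of_nonneg_right ?_ (sq_nonneg _)
  calc ∑ i, ∑ j, M i j ^ 2 ≤ ∑ _i : Fin N, ∑ _j : Fin N, a ^ 2 :=
        Finset.sum_le_sum fun i _ => Finset.sum_le_sum fun j _ => sq_le_sq.2 (by
          rw [abs_of_nonneg ha]; exact h i j)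
    _ = (N * a) ^ 2 := by simp; ring

/-- By symmetry and Cauchy–Schwarz, `n ↦ ‖(T ^ n) x‖` is log-convex, so its successive ratios are at
least the first one. This takes the place of diagonalisation. -/
lemma norm_mul_norm_pow_le {E : Type*} [NormedAddCommGroup E] [InnerProductSpace ℝ E]
    {T : E →L[ℝ] E} (hT : ∀ x y, inner ℝ (T x) y = inner ℝ x (T y)) (x : E) (n : ℕ) :
    ‖x‖ * ‖T x‖ ^ n ≤ ‖x‖ ^ n * ‖(T ^ n) x‖ := by
  have hsucc : ∀ n, (T ^ (n + 1)) x = T ((T ^ n) x) := fun n => by rw [pow_succ']; rfl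
  have hconv : ∀ n, ‖(T ^ (n + 1)) x‖ ^ 2 ≤ ‖(T ^ n) x‖ * ‖(T ^ (n + 2)) x‖ := fun n => by
    rw [← real_inner_self_eq_norm_sq]
    nth_rw 1 [hsucc]
    rw [hT, ← hsucc]
    exact real_inner_le_norm _ _
  have hstep : ∀ n, ‖T x‖ * ‖(T ^ n) x‖ ≤ ‖x‖ * ‖(T ^ (n + 1)) x‖ := fun n => by
    induction n with
    | zero => simp [mul_comm]
    | succ n ih =>
      rcases (norm_nonneg ((T ^ n) x)).eq_or_lt with h | h
      · have : (T ^ (n + 1)) x = 0 := by rw [hsucc, norm_eq_zero.1 h.symm, map_zero]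
        rw [this, norm_zero, mul_zero]
        positivity
      · refine le_of_mul_le_mul_right ?_ h
        calc ‖T x‖ * ‖(T ^ (n + 1)) x‖ * ‖(T ^ n) x‖
            = ‖T x‖ * ‖(T ^ n) x‖ * ‖(T ^ (n + 1)) x‖ := by ring
          _ ≤ ‖x‖ * ‖(T ^ (n + 1)) x‖ * ‖(T ^ (n + 1)) x‖ := by gcongr
          _ = ‖x‖ * ‖(T ^ (n + 1)) x‖ ^ 2 := by ring
          _ ≤ ‖x‖ * (‖(T ^ n) x‖ * ‖(T ^ (n + 2)) x‖) := by gcongr; exact hconv n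
          _ = _ := by ring
  induction n with
  | zero => simp
  | succ n ih =>
    calc ‖x‖ * ‖T x‖ ^ (n + 1) = ‖T x‖ * (‖x‖ * ‖T x‖ ^ n) := by ring
      _ ≤ ‖T x‖ * (‖x‖ ^ n * ‖(T ^ n) x‖) := by gcongr
      _ = ‖x‖ ^ n * (‖T x‖ * ‖(T ^ n) x‖) := by ring
      _ ≤ ‖x‖ ^ n * (‖x‖ * ‖(T ^ (n + 1)) x‖) := 
        mul_le_mul_of_nonneg_left (hstep n) (by positivity)
      _ = _ := by ring

lemma inner_toEuclideanCLM_comm {M : Matrix (Fin N) (Fin N) ℝ} (hM : M.IsSymm)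
    (v w : EuclideanSpace ℝ (Fin N)) :
    inner ℝ (Matrix.toEuclideanCLM (n := Fin N) (𝕜 := ℝ) M v) w =
      inner ℝ v (Matrix.toEuclideanCLM (n := Fin N) (𝕜 := ℝ) M w) := by
  have h : star (Matrix.toEuclideanCLM (n := Fin N) (𝕜 := ℝ) M) =
      Matrix.toEuclideanCLM (n := Fin N) (𝕜 := ℝ) M := by
    rw [← map_star, Matrix.star_eq_conjTranspose, Matrix.conjTranspose_eq_transpose_of_trivial,
      hM.eq]
  nth_rw 2 [← h]
  rw [ContinuousLinearMap.star_eq_adjoint, ContinuousLinearMap.adjoint_inner_right]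

lemma trace_pow_two_mul {M : Matrix (Fin N) (Fin N) ℝ} (hM : M.IsSymm) (p : ℕ) :
    (M ^ (2 * p)).trace = ∑ i, ∑ j, (M ^ p) i j ^ 2 := by
  rw [two_mul, pow_add]
  simp only [Matrix.trace, Matrix.diag_apply, Matrix.mul_apply]
  refine Finset.sum_congr rfl fun i _ => Finset.sum_congr rfl fun j _ => ?_
  rw [(hM.pow p).apply i j, sq]

lemma trace_pow_two_mul_nonneg {M : Matrix (Fin N) (Fin N) ℝ} (hM : M.IsSymm) (p : ℕ) :
    0 ≤ (M ^ (2 * p)).trace := by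
  rw [trace_pow_two_mul hM]
  exact Finset.sum_nonneg fun i _ => Finset.sum_nonneg fun j _ => sq_nonneg _

/-- The trace of `M ^ (2 * p)` is the squared Frobenius norm of `M ^ p`, which bounds `‖(T ^ p) v‖`.
Log-convexity passes from `T ^ p` to `T`. -/
lemma opNorm_le_of_trace_pow_le {M : Matrix (Fin N) (Fin N) ℝ} (hM : M.IsSymm) {p : ℕ}
    (hp : p ≠ 0) {s : ℝ} (hs : 0 ≤ s) (h : (M ^ (2 * p)).trace ≤ s ^ (2 * p)) : opNorm M ≤ s := by
  refine ContinuousLinearMap.opNorm_le_bound _ hs fun v => ?_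
  set T := Matrix.toEuclideanCLM (n := Fin N) (𝕜 := ℝ) M with hTdef
  rcases (norm_nonneg v).eq_or_lt with hv | hv
  · rw [norm_eq_zero.1 hv.symm]; simp
  have h1 := norm_mul_norm_pow_le (inner_toEuclideanCLM_comm hM) v p
  have h2 : ‖(T ^ p) v‖ ≤ s ^ p * ‖v‖ := by
    refine abs_le_of_sq_le_sq' ?_ (by positivity) |>.2
    rw [hTdef, ← map_pow, mul_pow, ← pow_mul, mul_comm p]
    refine (norm_toEuclideanCLM_apply_le _ v).trans ?_
    rw [← trace_pow_two_mul hM]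
    gcongr
  refine le_of_pow_le_pow_left₀ hp (by positivity) ?_
  refine le_of_mul_le_mul_left ?_ hv
  calc ‖v‖ * ‖T v‖ ^ p ≤ ‖v‖ ^ p * ‖(T ^ p) v‖ := h1
    _ ≤ ‖v‖ ^ p * (s ^ p * ‖v‖) := by gcongr
    _ = ‖v‖ * (s * ‖v‖) ^ p := by ring

end Norm

/-! ### Truncation, centring and the tail bound for the norm -/

section Truncation

/-- Truncation of a real number at level `c`. -/
noncomputable def truncate (c t : ℝ) : ℝ := if |t| ≤ c then t else 0

lemma measurable_truncate (c : ℝ) : Measurable (truncate c) :=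
  Measurable.ite (measurableSet_le measurable_norm measurable_const) measurable_id
    measurable_const

lemma abs_truncate_le {c : ℝ} (hc : 0 ≤ c) (t : ℝ) : |truncate c t| ≤ c := by
  unfold truncate
  split_ifs with h
  · exact h
  · simpa using hc

lemma truncate_sq_le (c t : ℝ) : truncate c t ^ 2 ≤ t ^ 2 := by
  unfold truncate
  split_ifs
  · exact le_rfl
  · simpa using sq_nonneg t

lemma abs_truncate_sub_le {c : ℝ} (hc : 0 < c) (t : ℝ) (k : ℕ) :
    |truncate c t - t| ≤ |t| ^ (k + 1) / c ^ k := by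
  unfold truncate
  split_ifs with h
  · rw [sub_self, abs_zero]; positivity
  · rw [zero_sub, abs_neg, le_div_iff₀ (by positivity), pow_succ, mul_comm]
    have : c ^ k ≤ |t| ^ k := pow_le_pow_left₀ hc.le (not_le.1 h).le k
    gcongr

lemma isSymm_edgeMatrix {Ω : Type*} {N : ℕ} {A : Fin N → Finset (Fin N)} (hA : ∀ i j, j ∈ A i ↔ i ∈ A j)
    (x : Sym2 (Fin N) → Ω → ℝ) (ω : Ω) : (edgeMatrix A x ω).IsSymm := by
  ext i j
  simp only [edgeMatrix, Matrix.transpose_apply, Matrix.of_apply, hA j i, Sym2.eq_swap (a := j)]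

variable {Ω : Type*} [MeasurableSpace Ω] {P : Measure Ω} [IsProbabilityMeasure P]

lemma integrable_truncate {X : Ω → ℝ} (hX : Measurable X) {c : ℝ} (hc : 0 ≤ c) :
    Integrable (fun ω => truncate c (X ω)) P :=
  Integrable.of_bound (C := c) ((measurable_truncate c).comp hX).aestronglyMeasurable
    (Eventually.of_forall fun _ => abs_truncate_le hc _)

lemma abs_integral_truncate_le_of_nonneg (X : Ω → ℝ) {c : ℝ} (hc : 0 ≤ c) :
    |∫ ω, truncate c (X ω) ∂P| ≤ c := by
  have := norm_integral_le_of_norm_le_const (μ := P) (f := fun ω => truncate c (X ω)) (C := c)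
    (Eventually.of_forall fun _ => abs_truncate_le hc _)
  simpa using this

lemma abs_integral_truncate_le {X : Ω → ℝ} (hX : Measurable X) (h1 : ∫ ω, X ω ∂P = 0)
    (hint : ∀ k : ℕ, Integrable (fun ω => |X ω| ^ k) P) {c : ℝ} (hc : 0 < c) (k : ℕ) :
    |∫ ω, truncate c (X ω) ∂P| ≤ (∫ ω, |X ω| ^ (k + 1) ∂P) / c ^ k := by
  have hXi : Integrable X P := by
    have := hint 1
    simp only [pow_one] at this
    exact (integrable_norm_iff hX.aestronglyMeasurable).1 this
  have h : ∫ ω, truncate c (X ω) ∂P = ∫ ω, (truncate c (X ω) - X ω) ∂P := by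
    rw [integral_sub (integrable_truncate hX hc.le) hXi, h1, sub_zero]
  rw [h, ← integral_div, ← Real.norm_eq_abs]
  exact norm_integral_le_of_norm_le ((hint _).div_const _)
    (Eventually.of_forall fun ω => abs_truncate_sub_le hc _ k)

lemma integral_sq_truncate_sub_le {X : Ω → ℝ} (hX : Measurable X)
    (h2 : ∫ ω, X ω ^ 2 ∂P = 1) {c : ℝ} (hc : 0 ≤ c) :
    ∫ ω, (truncate c (X ω) - ∫ ω', truncate c (X ω') ∂P) ^ 2 ∂P ≤ 1 := by
  set a := ∫ ω', truncate c (X ω') ∂P with ha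
  have hi := integrable_truncate (P := P) hX hc
  have hX2 : Integrable (fun ω => X ω ^ 2) P := by
    -- A non-integrable function has integral 0 by convention, so the value 1 forces integrability.
    by_contra h
    rw [integral_undef h] at h2
    exact zero_ne_one h2
  have hi2 : Integrable (fun ω => truncate c (X ω) ^ 2) P :=
    hX2.mono' (((measurable_truncate c).comp hX).pow_const 2).aestronglyMeasurable
      (Eventually.of_forall fun ω => by
        rw [Real.norm_eq_abs, abs_of_nonneg (sq_nonneg _)]
        exact truncate_sq_le _ _)
  have h3 : ∫ ω, truncate c (X ω) ^ 2 ∂P ≤ 1 :=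
    (integral_mono hi2 hX2 fun ω => truncate_sq_le _ _).trans_eq h2
  have h4 : ∫ ω, (truncate c (X ω) - a) ^ 2 ∂P =
      ∫ ω, (truncate c (X ω) ^ 2 - 2 * a * truncate c (X ω) + a ^ 2) ∂P :=
    integral_congr_ae (Eventually.of_forall fun ω => by ring)
  have h5 : Integrable (fun ω => truncate c (X ω) ^ 2 - 2 * a * truncate c (X ω)) P :=
    hi2.sub (hi.const_mul _)
  rw [h4, integral_add h5 (integrable_const _), integral_sub hi2 (hi.const_mul _),
    integral_const_mul, ← ha]
  simp only [integral_const, probReal_univ, smul_eq_mul, one_mul]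
  nlinarith [sq_nonneg a]

variable {N : ℕ} {x : Sym2 (Fin N) → Ω → ℝ}

lemma measureReal_lt_abs_le {X : Ω → ℝ} {k : ℕ} (hint : Integrable (fun ω => |X ω| ^ k) P)
    {c : ℝ} (hc : 0 < c) : P.real {ω | c < |X ω|} ≤ (∫ ω, |X ω| ^ k ∂P) / c ^ k := by
  have h := mul_meas_ge_le_integral_of_nonneg (μ := P) (f := fun ω => |X ω| ^ k)
    (Eventually.of_forall fun ω => by positivity) hint (c ^ k)
  rw [le_div_iff₀ (by positivity), mul_comm]
  refine le_trans ?_ h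
  refine mul_le_mul_of_nonneg_left (measureReal_mono fun ω hω => ?_) (by positivity)
  exact pow_le_pow_left₀ hc.le (le_of_lt hω) k

lemma card_sym2_fin_le (N : ℕ) : (Fintype.card (Sym2 (Fin N)) : ℝ) ≤ (N : ℝ) ^ 2 := by
  have h : Fintype.card (Sym2 (Fin N)) ≤ Fintype.card (Fin N × Fin N) :=
    Fintype.card_le_of_surjective (fun p : Fin N × Fin N => s(p.1, p.2)) fun e => by
      induction e with
      | _ a b => exact ⟨(a, b), rfl⟩
  rw [Fintype.card_prod, Fintype.card_fin, ← sq] at h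
  exact_mod_cast h

/-- Unless some entry exceeds `c`, the matrix is its truncated centred version plus a deterministic
matrix of means. The means are tiny because the original entries are centred and have high moments.
-/
theorem measureReal_lt_opNorm_edgeMatrix_le (hx : ∀ e, Measurable (x e)) (hind : iIndepFun x P)
    (h1 : ∀ e, ∫ ω, x e ω ∂P = 0) (h2 : ∀ e, ∫ ω, x e ω ^ 2 ∂P = 1)
    (hint : ∀ e, ∀ k : ℕ, Integrable (fun ω => |x e ω| ^ k) P)
    {mom : ℕ → ℝ} (hmom : ∀ e k, ∫ ω, |x e ω| ^ k ∂P ≤ mom k) (hmom0 : ∀ k, 0 ≤ mom k)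
    {A : Fin N → Finset (Fin N)} (hAs : ∀ i j, j ∈ A i ↔ i ∈ A j) {q : ℝ} (hq : 0 < q)
    (hA : ∀ u, ((A u).card : ℝ) ≤ q ^ 2) {c : ℝ} {p : ℕ} (hp : p ≠ 0)
    (hpc : 1 + 2 * (p : ℝ) ≤ c) {ρ σ : ℝ} (hρ : 2 + c ^ 3 / q ^ 2 + 2 * c ^ 3 / q ≤ ρ)
    (hσ : 0 < σ) (k : ℕ) :
    P.real {ω | σ * q + N * (mom (k + 1) / c ^ k) < opNorm (edgeMatrix A x ω)} ≤
      N ^ 2 * (mom k / c ^ k) + N * (ρ / σ) ^ (2 * p) := by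
  have hp0 : (0 : ℝ) ≤ p := Nat.cast_nonneg p
  have hc : 0 < c := by linarith
  set a : Sym2 (Fin N) → ℝ := fun e => ∫ ω, truncate c (x e ω) ∂P with ha
  set y : Sym2 (Fin N) → Ω → ℝ := fun e ω => truncate c (x e ω) - a e with hy
  have hym : ∀ e, Measurable (y e) := fun e =>
    ((measurable_truncate c).comp (hx e)).sub_const _
  have hyb : ∀ e ω, |y e ω| ≤ 2 * c := fun e ω => by
    refine (abs_sub _ _).trans ?_
    have := abs_truncate_le hc.le (x e ω)
    have : |a e| ≤ c := abs_integral_truncate_le_of_nonneg (x e) hc.le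
    linarith
  have hyi : iIndepFun y P :=
    hind.comp (fun e t => truncate c t - a e) fun e => (measurable_truncate c).sub_const _
  have hy1 : ∀ e, ∫ ω, y e ω ∂P = 0 := fun e => by
    simp only [hy]
    rw [integral_sub (integrable_truncate (hx e) hc.le) (integrable_const _)]
    simp [ha]
  have hy2 : ∀ e, ∫ ω, y e ω ^ 2 ∂P ≤ 1 := fun e =>
    integral_sq_truncate_sub_le (hx e) (h2 e) hc.le
  -- Centring doubles the entry bound, so `K = 2 * c`. With `L = c` this gives the term `2 * c ^ 3 /
  -- q`.
  obtain ⟨hti, ht⟩ := integral_trace_edgeMatrix_pow_le hym hyb hyi hy1 hy2 (A := A) (L := c)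
    (q := q) (ρ := ρ) (by linarith) hq (by convert hρ using 2; ring) hA (2 * p)
    (by push_cast; linarith)
  set E : Set Ω := {ω | (σ * q) ^ (2 * p) ≤ (edgeMatrix A y ω ^ (2 * p)).trace} with hE
  have hsub : {ω | σ * q + N * (mom (k + 1) / c ^ k) < opNorm (edgeMatrix A x ω)} ⊆
      (⋃ e, {ω | c < |x e ω|}) ∪ E := by
    intro ω hω
    by_contra hcon
    simp only [Set.mem_union, Set.mem_iUnion, Set.mem_ofPred_eq, not_or, not_exists, not_lt,
      hE, not_le] at hcon hω
    obtain ⟨hc1, hc2⟩ := hcon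
    have hsplit : edgeMatrix A x ω = edgeMatrix A y ω + edgeMatrix A (fun e _ => a e) ω := by
      ext i j
      simp only [edgeMatrix, Matrix.add_apply, Matrix.of_apply]
      split_ifs
      · simp [hy, truncate, hc1 s(i, j)]
      · simp
    have hn1 : opNorm (edgeMatrix A y ω) ≤ σ * q :=
      opNorm_le_of_trace_pow_le (isSymm_edgeMatrix hAs y ω) hp (by positivity) hc2.le
    have hk : 0 ≤ mom (k + 1) / c ^ k := div_nonneg (hmom0 _) (by positivity)
    have hn2 : opNorm (edgeMatrix A (fun e _ => a e) ω) ≤ N * (mom (k + 1) / c ^ k) := by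
      refine opNorm_le_of_abs_le hk fun i j => ?_
      simp only [edgeMatrix, Matrix.of_apply]
      split_ifs
      · refine (abs_integral_truncate_le (hx _) (h1 _) (hint _) hc k).trans ?_
        have := hmom s(i, j) (k + 1)
        gcongr
      · simpa using hk
    have := opNorm_add_le (edgeMatrix A y ω) (edgeMatrix A (fun e _ => a e) ω)
    rw [← hsplit] at this
    linarith
  have hE' : P.real E ≤ N * (ρ / σ) ^ (2 * p) := by
    have h := mul_meas_ge_le_integral_of_nonneg (μ := P)
      (f := fun ω => (edgeMatrix A y ω ^ (2 * p)).trace)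
      (Eventually.of_forall fun ω => trace_pow_two_mul_nonneg (isSymm_edgeMatrix hAs y ω) p) hti
      ((σ * q) ^ (2 * p))
    have h3 := h.trans ht
    rw [mul_comm, ← le_div_iff₀ (by positivity), Fintype.card_fin] at h3
    refine h3.trans_eq ?_
    rw [mul_div_assoc, ← div_pow, mul_div_mul_right _ _ hq.ne']
  have hU : P.real (⋃ e, {ω | c < |x e ω|}) ≤ N ^ 2 * (mom k / c ^ k) := by
    refine (measureReal_iUnion_fintype_le _).trans ?_
    have hterm : ∀ e ∈ Finset.univ, P.real {ω | c < |x e ω|} ≤ mom k / c ^ k := fun e _ => by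
      refine (measureReal_lt_abs_le (hint e k) hc).trans ?_
      have := hmom e k
      gcongr
    refine (Finset.sum_le_sum hterm).trans ?_
    rw [Finset.sum_const, nsmul_eq_mul, Finset.card_univ]
    exact mul_le_mul_of_nonneg_right (card_sym2_fin_le N) (div_nonneg (hmom0 _) (by positivity))
  calc P.real {ω | σ * q + N * (mom (k + 1) / c ^ k) < opNorm (edgeMatrix A x ω)}
      ≤ P.real ((⋃ e, {ω | c < |x e ω|}) ∪ E) := measureReal_mono hsub
    _ ≤ P.real (⋃ e, {ω | c < |x e ω|}) + P.real E := measureReal_union_le _ _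
    _ ≤ _ := add_le_add hU hE'

end Truncation

/-! ### Choice of parameters and Borel–Cantelli -/

section Asymptotics

/-- A sequence that grows at least like a power of `N` has an integer eighth root that still
dominates a power of `N`. -/
lemma exists_eighth_root {β : ℕ → ℕ} (hβ : ∀ N, 1 ≤ β N) {C γ : ℝ} (hC : 0 < C) (hγ : 0 < γ)
    (hgrowth : ∀ N : ℕ, 1 ≤ N → C * (N : ℝ) ^ γ ≤ (β N : ℝ)) :
    ∃ (l : ℕ → ℕ) (d : ℕ) (M : ℝ), 0 ≤ M ∧ Tendsto l atTop atTop ∧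
      (∀ N, (l N : ℝ) ^ 8 ≤ β N) ∧ ∀ N : ℕ, (N : ℝ) ≤ M * (l N : ℝ) ^ d := by
  set l : ℕ → ℕ := fun N => ⌊(β N : ℝ) ^ (1 / 8 : ℝ)⌋₊ with hl
  have hroot : ∀ N, ((β N : ℝ) ^ (1 / 8 : ℝ)) ^ 8 = β N := fun N => by
    rw [← Real.rpow_natCast, ← Real.rpow_mul (Nat.cast_nonneg _)]
    norm_num
  have hl1 : ∀ N, 1 ≤ l N := fun N =>
    Nat.le_floor (by
      rw [Nat.cast_one]
      exact Real.one_le_rpow (by exact_mod_cast hβ N) (by norm_num))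
  have hl8 : ∀ N, (l N : ℝ) ^ 8 ≤ β N := fun N => by
    rw [← hroot N]
    exact pow_le_pow_left₀ (Nat.cast_nonneg _) (Nat.floor_le (by positivity)) 8
  have hβl : ∀ N, (β N : ℝ) ≤ 256 * (l N : ℝ) ^ 8 := fun N => by
    have h1 : (1 : ℝ) ≤ l N := by exact_mod_cast hl1 N
    have h2 : (β N : ℝ) ^ (1 / 8 : ℝ) ≤ 2 * l N := by
      have := (Nat.lt_floor_add_one ((β N : ℝ) ^ (1 / 8 : ℝ))).le
      simp only [hl] at h1 ⊢
      linarith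
    calc (β N : ℝ) = ((β N : ℝ) ^ (1 / 8 : ℝ)) ^ 8 := (hroot N).symm
      _ ≤ (2 * l N) ^ 8 := pow_le_pow_left₀ (by positivity) h2 8
      _ = _ := by ring
  -- From `C * N ^ γ ≤ β ≤ 256 * l ^ 8`, taking the power `1 / γ` yields `d` and `M`.
  set d := ⌈8 / γ⌉₊ with hd
  set M := (256 / C) ^ (1 / γ) with hM
  have hNl : ∀ N : ℕ, (N : ℝ) ≤ M * (l N : ℝ) ^ d := fun N => by
    rcases Nat.eq_zero_or_pos N with rfl | hN
    · rw [Nat.cast_zero]; positivity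
    have h1 : (1 : ℝ) ≤ l N := by exact_mod_cast hl1 N
    have h2 : (N : ℝ) ^ γ ≤ 256 / C * (l N : ℝ) ^ (8 : ℝ) := by
      rw [div_mul_eq_mul_div, le_div_iff₀ hC, mul_comm]
      refine ((hgrowth N hN).trans (hβl N)).trans_eq ?_
      rw [← Real.rpow_natCast]
      norm_num
    calc (N : ℝ) = ((N : ℝ) ^ γ) ^ (1 / γ) := by
          rw [← Real.rpow_mul (Nat.cast_nonneg _), mul_one_div_cancel hγ.ne', Real.rpow_one]
      _ ≤ (256 / C * (l N : ℝ) ^ (8 : ℝ)) ^ (1 / γ) :=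
          Real.rpow_le_rpow (by positivity) h2 (by positivity)
      _ = M * (l N : ℝ) ^ (8 / γ) := by
          rw [Real.mul_rpow (by positivity) (by positivity), ← Real.rpow_mul (by positivity),
            mul_one_div]
      _ ≤ M * (l N : ℝ) ^ d := by
          rw [← Real.rpow_natCast]
          exact mul_le_mul_of_nonneg_left (Real.rpow_le_rpow_of_exponent_le h1 (Nat.le_ceil _))
            (by positivity)
  refine ⟨l, d, M, by positivity, tendsto_atTop.2 fun B => ?_, hl8, hNl⟩
  filter_upwards [tendsto_natCast_atTop_atTop.eventually_gt_atTop (M * (B : ℝ) ^ d)] with N hN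
  by_contra hB
  refine absurd (hNl N) (not_le.2 (lt_of_le_of_lt ?_ hN))
  have : (l N : ℝ) ≤ B := by exact_mod_cast (not_le.1 hB).le
  gcongr

lemma exists_pow_mul_pow_le (n : ℕ) {θ : ℝ} (h0 : 0 ≤ θ) (h1 : θ < 1) :
    ∃ B : ℝ, ∀ l : ℕ, (l : ℝ) ^ n * θ ^ l ≤ B := by
  obtain ⟨B, hB⟩ := (tendsto_pow_const_mul_const_pow_of_abs_lt_one n
    (by rwa [abs_of_nonneg h0])).bddAbove_range
  exact ⟨B, fun l => hB ⟨l, rfl⟩⟩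

variable {Ω : Type*} [MeasurableSpace Ω] {P : Measure Ω} [IsProbabilityMeasure P]

lemma ae_eventually_notMem_of_measureReal_le {s : ℕ → Set Ω} {B : ℝ}
    (h : ∀ᶠ N : ℕ in atTop, P.real (s N) ≤ B * (1 / (N : ℝ) ^ 2)) :
    ∀ᵐ ω ∂P, ∀ᶠ N in atTop, ω ∉ s N := by
  have hsum : Summable fun N => P.real (s N) := by
    refine summable_of_isBigO_nat (Real.summable_one_div_nat_pow.2 one_lt_two)
      (Asymptotics.IsBigO.of_bound B ?_)
    filter_upwards [h] with N hN
    rwa [Real.norm_of_nonneg measureReal_nonneg, Real.norm_of_nonneg (by positivity)]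
  refine ae_eventually_notMem ?_
  simpa using hsum.tsum_ofReal_ne_top

variable {x : ∀ N : ℕ, Sym2 (Fin N) → Ω → ℝ}

lemma ae_eventually_opNorm_edgeMatrix_le (hx : ∀ N e, Measurable (x N e))
    (hind : ∀ N, iIndepFun (x N) P) (h1 : ∀ N e, ∫ ω, x N e ω ∂P = 0)
    (h2 : ∀ N e, ∫ ω, x N e ω ^ 2 ∂P = 1)
    (hint : ∀ N e, ∀ k : ℕ, Integrable (fun ω => |x N e ω| ^ k) P)
    {mom : ℕ → ℝ} (hmom : ∀ N e k, ∫ ω, |x N e ω| ^ k ∂P ≤ mom k) (hmom0 : ∀ k, 0 ≤ mom k)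
    {A : ∀ N, Fin N → Finset (Fin N)} (hAs : ∀ N i j, j ∈ A N i ↔ i ∈ A N j)
    {β : ℕ → ℕ} (hβ : ∀ N, 1 ≤ β N) (hA : ∀ N u, (A N u).card ≤ β N)
    {C γ : ℝ} (hC : 0 < C) (hγ : 0 < γ)
    (hgrowth : ∀ N : ℕ, 1 ≤ N → C * (N : ℝ) ^ γ ≤ (β N : ℝ)) {ε : ℝ} (hε : 0 < ε) :
    ∀ᵐ ω ∂P, ∀ᶠ N in atTop, opNorm (edgeMatrix (A N) (x N) ω) ≤ (2 + 3 * ε) * √(β N : ℝ) := by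
  obtain ⟨l, d, M, hM, hlim, hl8, hNl⟩ := exists_eighth_root hβ hC hγ hgrowth
  have hlimR : Tendsto (fun N => (l N : ℝ)) atTop atTop := tendsto_natCast_atTop_atTop.comp hlim
  -- The ratio `ρ / σ` for `ρ = 2 + ε` and `σ = 2 + 2 * ε`; the third `ε` of the conclusion absorbs
  -- the matrix of means.
  set θ := (2 + ε) / (2 + 2 * ε) with hθ
  have hθ0 : 0 < θ := by positivity
  have hθ1 : θ < 1 := by rw [hθ, div_lt_one (by positivity)]; linarith
  obtain ⟨B, hB⟩ := exists_pow_mul_pow_le (d * 3) hθ0.le hθ1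
  -- Makes `l ^ k` dominate `N ^ 4`, so the union bound over at most `N ^ 2` entries is of order `1
  -- / N ^ 2`.
  set k := d * 4 with hk
  have hN4 : ∀ N : ℕ, 1 ≤ l N → (N : ℝ) ^ 4 / (l N : ℝ) ^ k ≤ M ^ 4 := fun N hN => by
    have : (0 : ℝ) < l N := by exact_mod_cast hN
    rw [div_le_iff₀ (by positivity), hk, pow_mul, ← mul_pow]
    exact pow_le_pow_left₀ (Nat.cast_nonneg _) (hNl N) 4
  have hN3 : ∀ N : ℕ, (N : ℝ) ^ 3 * θ ^ l N ≤ M ^ 3 * B := fun N => by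
    calc (N : ℝ) ^ 3 * θ ^ l N ≤ (M * (l N : ℝ) ^ d) ^ 3 * θ ^ l N := by
          gcongr; exact hNl N
      _ = M ^ 3 * ((l N : ℝ) ^ (d * 3) * θ ^ l N) := by rw [pow_mul]; ring
      _ ≤ M ^ 3 * B := by gcongr; exact hB _
  have hbad : ∀ᵐ ω ∂P, ∀ᶠ N in atTop, ω ∉ {ω | (2 + 2 * ε) * √(β N : ℝ) +
      N * (mom (k + 1) / (l N : ℝ) ^ k) < opNorm (edgeMatrix (A N) (x N) ω)} := by
    refine ae_eventually_notMem_of_measureReal_le (B := mom k * M ^ 4 + M ^ 3 * B / θ ^ 2) ?_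
    filter_upwards [hlim.eventually_ge_atTop 3, hlimR.eventually_ge_atTop (3 / ε),
      eventually_ge_atTop 1] with N hl3 hlε hN1
    have hl0 : (0 : ℝ) < l N := by exact_mod_cast (by omega : 0 < l N)
    have hl1 : (1 : ℝ) ≤ l N := by exact_mod_cast (by omega : 1 ≤ l N)
    have hNpos : (0 : ℝ) < N := by exact_mod_cast hN1
    have hβ0 : (0 : ℝ) < β N := by exact_mod_cast hβ N
    set q := √(β N : ℝ) with hq
    have hq2 : q ^ 2 = β N := Real.sq_sqrt hβ0.le
    have hq0 : 0 < q := Real.sqrt_pos.2 hβ0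
    -- The eighth root is chosen for this: the error `l ^ 3 / q` is then at most `1 / l`.
    have hql : (l N : ℝ) ^ 4 ≤ q := Real.le_sqrt_of_sq_le (by
      rw [← pow_mul]; exact hl8 N)
    have hq1 : 1 ≤ q := (one_le_pow₀ hl1).trans hql
    have hsmall : (l N : ℝ) ^ 3 / q ≤ ε / 3 := by
      calc (l N : ℝ) ^ 3 / q ≤ (l N : ℝ) ^ 3 / (l N : ℝ) ^ 4 := by gcongr
        _ = 1 / (l N : ℝ) := by field_simp
        _ ≤ ε / 3 := by
          rw [div_le_iff₀ hl0]
          rw [div_le_iff₀ hε] at hlε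
          linarith
    have hρ : 2 + (l N : ℝ) ^ 3 / q ^ 2 + 2 * (l N : ℝ) ^ 3 / q ≤ 2 + ε := by
      have : (l N : ℝ) ^ 3 / q ^ 2 ≤ (l N : ℝ) ^ 3 / q := by
        gcongr
        exact le_self_pow₀ hq1 two_ne_zero
      rw [mul_div_assoc]
      linarith
    -- A walk of `2 * p` steps meets at most `2 * p + 1` vertices, which must not exceed `L = l N`.
    -- Rounding costs at most the factor `1 / θ ^ 2`.
    obtain ⟨p, hp0, hp1, hp2⟩ : ∃ p, p ≠ 0 ∧ 1 + 2 * p ≤ l N ∧ l N ≤ 2 * p + 2 :=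
      ⟨(l N - 1) / 2, by omega, by omega, by omega⟩
    refine (measureReal_lt_opNorm_edgeMatrix_le (hx N) (hind N) (h1 N) (h2 N) (hint N) (hmom N)
      hmom0 (hAs N) hq0 (fun u => by rw [hq2]; exact_mod_cast hA N u) hp0
      (by exact_mod_cast hp1) hρ (by positivity) k).trans ?_
    have ht1 : (N : ℝ) ^ 2 * (mom k / (l N : ℝ) ^ k) ≤ mom k * M ^ 4 * (1 / (N : ℝ) ^ 2) := by
      rw [mul_one_div, le_div_iff₀ (by positivity)]
      calc (N : ℝ) ^ 2 * (mom k / (l N : ℝ) ^ k) * (N : ℝ) ^ 2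
          = mom k * ((N : ℝ) ^ 4 / (l N : ℝ) ^ k) := by ring
        _ ≤ mom k * M ^ 4 := mul_le_mul_of_nonneg_left (hN4 N (by omega)) (hmom0 k)
    have ht2 : (N : ℝ) * θ ^ (2 * p) ≤ M ^ 3 * B / θ ^ 2 * (1 / (N : ℝ) ^ 2) := by
      rw [mul_one_div, le_div_iff₀ (by positivity), le_div_iff₀ (by positivity)]
      calc (N : ℝ) * θ ^ (2 * p) * (N : ℝ) ^ 2 * θ ^ 2 = (N : ℝ) ^ 3 * θ ^ (2 * p + 2) := by ring
        _ ≤ (N : ℝ) ^ 3 * θ ^ l N :=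
          mul_le_mul_of_nonneg_left (pow_le_pow_of_le_one hθ0.le hθ1.le hp2) (by positivity)
        _ ≤ M ^ 3 * B := hN3 N
    rw [add_mul]
    exact add_le_add ht1 ht2
  filter_upwards [hbad] with ω hω
  filter_upwards [hω, hlim.eventually_ge_atTop 1, eventually_ge_atTop 1,
    hlimR.eventually_ge_atTop (mom (k + 1) * M ^ 4 / ε)] with N hN hl1 hN1 hlm
  rw [not_lt] at hN
  have hl1' : (1 : ℝ) ≤ l N := by exact_mod_cast hl1
  have hN1' : (1 : ℝ) ≤ N := by exact_mod_cast hN1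
  have hql : (l N : ℝ) ≤ √(β N : ℝ) := Real.le_sqrt_of_sq_le
    ((pow_le_pow_right₀ hl1' (by norm_num)).trans (hl8 N))
  have hlast : (N : ℝ) * (mom (k + 1) / (l N : ℝ) ^ k) ≤ ε * √(β N : ℝ) := by
    calc (N : ℝ) * (mom (k + 1) / (l N : ℝ) ^ k) = mom (k + 1) * ((N : ℝ) / (l N : ℝ) ^ k) := by
          ring
      _ ≤ mom (k + 1) * ((N : ℝ) ^ 4 / (l N : ℝ) ^ k) := by
          refine mul_le_mul_of_nonneg_left ?_ (hmom0 _)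
          gcongr
          exact le_self_pow₀ hN1' (by norm_num)
      _ ≤ mom (k + 1) * M ^ 4 := mul_le_mul_of_nonneg_left (hN4 N hl1) (hmom0 _)
      _ ≤ ε * l N := by
          rw [div_le_iff₀ hε] at hlm
          linarith
      _ ≤ ε * √(β N : ℝ) := by gcongr
  linarith

theorem ae_limsup_opNorm_edgeMatrix_le (hx : ∀ N e, Measurable (x N e))
    (hind : ∀ N, iIndepFun (x N) P) (h1 : ∀ N e, ∫ ω, x N e ω ∂P = 0)
    (h2 : ∀ N e, ∫ ω, x N e ω ^ 2 ∂P = 1)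
    (hint : ∀ N e, ∀ k : ℕ, Integrable (fun ω => |x N e ω| ^ k) P)
    {mom : ℕ → ℝ} (hmom : ∀ N e k, ∫ ω, |x N e ω| ^ k ∂P ≤ mom k) (hmom0 : ∀ k, 0 ≤ mom k)
    {A : ∀ N, Fin N → Finset (Fin N)} (hAs : ∀ N i j, j ∈ A N i ↔ i ∈ A N j)
    {β : ℕ → ℕ} (hβ : ∀ N, 1 ≤ β N) (hA : ∀ N u, (A N u).card ≤ β N)
    {C γ : ℝ} (hC : 0 < C) (hγ : 0 < γ)
    (hgrowth : ∀ N : ℕ, 1 ≤ N → C * (N : ℝ) ^ γ ≤ (β N : ℝ)) :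
    ∀ᵐ ω ∂P, limsup (fun N : ℕ =>
      ((opNorm ((1 / √(β N : ℝ)) • edgeMatrix (A N) (x N) ω) : ℝ) : EReal)) atTop ≤ 2 := by
  have hall : ∀ᵐ ω ∂P, ∀ n : ℕ, ∀ᶠ N in atTop,
      opNorm (edgeMatrix (A N) (x N) ω) ≤ (2 + 3 * (1 / ((n : ℝ) + 1))) * √(β N : ℝ) :=
    ae_all_iff.2 fun n => ae_eventually_opNorm_edgeMatrix_le hx hind h1 h2 hint hmom hmom0 hAs hβ
      hA hC hγ hgrowth (by positivity)
  filter_upwards [hall] with ω hω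
  refine EReal.le_of_forall_lt_iff_le.1 fun z hz => ?_
  have hz' : (2 : ℝ) < z := EReal.coe_lt_coe_iff.1 hz
  obtain ⟨n, hn⟩ := exists_nat_one_div_lt (show (0 : ℝ) < (z - 2) / 3 by linarith)
  refine limsup_le_of_le (h := ?_)
  filter_upwards [hω n] with N hN
  have hβ0 : 0 < √(β N : ℝ) := Real.sqrt_pos.2 (by exact_mod_cast hβ N)
  rw [EReal.coe_le_coe_iff, opNorm_smul, abs_of_pos (by positivity), one_div_mul_eq_div,
    div_le_iff₀ hβ0]
  refine hN.trans ?_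
  gcongr
  linarith

end Asymptotics

/-! ### Application to banded and periodic band matrices -/

section Band

variable {Ω : Type*} [MeasurableSpace Ω] {P : Measure Ω}
  {Y : ∀ N : ℕ, Ω → Matrix (Fin N) (Fin N) ℝ}

/-- The entries of a matrix ensemble as a family indexed by unordered pairs. -/
def edgeEntry (Y : ∀ N : ℕ, Ω → Matrix (Fin N) (Fin N) ℝ) (N : ℕ) (e : Sym2 (Fin N)) (ω : Ω) : ℝ :=
  Y N ω e.inf e.sup

lemma IsMatrixEnsemble.edgeEntry_mk (hY : IsMatrixEnsemble Y) (N : ℕ) (i j : Fin N) (ω : Ω) :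
    edgeEntry Y N s(i, j) ω = Y N ω i j := by
  rcases le_total i j with h | h
  · simp [edgeEntry, h]
  · simp [edgeEntry, h, hY.symm N i j]

lemma IsWignerEnsemble.iIndepFun_edgeEntry (hY : IsWignerEnsemble P Y) (N : ℕ) :
    iIndepFun (edgeEntry Y N) P :=
  (hY.indep N).precomp (g := Sym2.sortEquiv (α := Fin N)) Sym2.sortEquiv.injective

lemma card_filter_cyclicAbs_le (b : ℕ) {N : ℕ} (i : Fin N) :
    (Finset.univ.filter fun j : Fin N =>
      cyclicAbs N (((i : ℕ) : ℤ) - ((j : ℕ) : ℤ)) ≤ (b : ℤ)).card ≤ 2 * b + 1 := by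
  have hcard : (Finset.Icc (-(b : ℤ)) b).card = 2 * b + 1 := by
    rw [Int.card_Icc]; omega
  rw [← hcard]
  -- Maps `j` to a representative of `j - i` modulo `N` in `[-b, b]`; it is injective since indices
  -- in `Fin N` are distinct modulo `N`.
  refine Finset.card_le_card_of_injOn (fun j : Fin N =>
    if |((i : ℕ) : ℤ) - ((j : ℕ) : ℤ)| ≤ (b : ℤ) then (j : ℤ) - (i : ℤ)
    else if (i : ℕ) < (j : ℕ) then (j : ℤ) - i - N else (j : ℤ) - i + N) ?_ ?_
  · intro j hj
    have hi := i.isLt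
    have hj' := j.isLt
    simp only [cyclicAbs, Finset.coe_Icc, Set.mem_Icc] at hj ⊢
    grind
  · intro j _ j' _ h
    have hi := i.isLt
    have hj := j.isLt
    have hj' := j'.isLt
    ext
    simp only at h
    grind

lemma cyclicAbs_sub_comm (N : ℕ) (s t : ℤ) : cyclicAbs N (s - t) = cyclicAbs N (t - s) := by
  unfold cyclicAbs
  rw [abs_sub_comm]

lemma card_filter_abs_sub_le (b : ℕ) {N : ℕ} (i : Fin N) :
    (Finset.univ.filter fun j : Fin N =>
      |((i : ℕ) : ℤ) - ((j : ℕ) : ℤ)| ≤ (b : ℤ)).card ≤ 2 * b + 1 :=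
  (Finset.card_le_card (Finset.monotone_filter_right _ fun _ _ h =>
    (min_le_left _ _).trans h)).trans (card_filter_cyclicAbs_le b i)

/-- The relation `R` covers both band shapes: symmetry and the row count are what the norm bound
needs, and reflexivity serves to transfer the moments. -/
theorem IsWignerEnsemble.ae_limsup_opNorm_le [IsProbabilityMeasure P] (hY : IsWignerEnsemble P Y)
    {b : ℕ → ℕ} {C γ : ℝ} (hC : 0 < C) (hγ : 0 < γ)
    (hgrowth : ∀ N : ℕ, 1 ≤ N → C * (N : ℝ) ^ γ ≤ (bandWidth b N : ℝ))
    {X : ∀ N : ℕ, Ω → Matrix (Fin N) (Fin N) ℝ} (hmom : AllMomentsExist P X)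
    (R : ∀ N, Fin N → Fin N → Prop) [∀ N i j, Decidable (R N i j)]
    (hRs : ∀ N i j, R N i j → R N j i) (hRr : ∀ N i, R N i i)
    (hR : ∀ N i, (Finset.univ.filter fun j => R N i j).card ≤ bandWidth b N)
    (hX : ∀ N ω i j, X N ω i j = if R N i j then Y N ω i j else 0) :
    ∀ᵐ ω ∂P, limsup (fun N : ℕ =>
      ((opNorm ((1 / √(bandWidth b N : ℝ)) • X N ω) : ℝ) : EReal)) atTop ≤ 2 := by
  set f : Ω → ℝ := fun ω => Y 1 ω 0 0 with hf
  have hid : ∀ N e, IdentDistrib (edgeEntry Y N e) f P P := fun N e => hY.identDistrib N 1 _ _ 0 0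
  have hidk : ∀ N e (k : ℕ), IdentDistrib (fun ω => |edgeEntry Y N e ω| ^ k)
      (fun ω => |f ω| ^ k) P P := fun N e k =>
    (hid N e).comp (u := fun t : ℝ => |t| ^ k) (measurable_norm.pow_const k)
  -- Moments are assumed for `X` only. A diagonal entry is never cut off, so it gives those of the
  -- common law of `Y`.
  have hfint : ∀ k : ℕ, Integrable (fun ω => |f ω| ^ k) P := fun k => by
    have h := hmom 1 0 0 k
    simpa only [hX, if_pos (hRr 1 0)] using h
  have hXe : ∀ N ω, X N ω =
      edgeMatrix (fun i => Finset.univ.filter fun j => R N i j) (edgeEntry Y N) ω := fun N ω => by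
    ext i j
    simp [edgeMatrix, hX, hY.edgeEntry_mk]
  simp only [hXe]
  exact ae_limsup_opNorm_edgeMatrix_le (fun N e => hY.measurable N _ _) hY.iIndepFun_edgeEntry
    (fun N e => hY.mean_zero N _ _) (fun N e => hY.second_moment N _ _)
    (fun N e k => (hidk N e k).integrable_iff.2 (hfint k))
    (mom := fun k => ∫ ω, |f ω| ^ k ∂P) (fun N e k => (hidk N e k).integral_eq.le)
    (fun k => integral_nonneg fun ω => by positivity)
    (fun N i j => by simpa using ⟨hRs N i j, hRs N j i⟩)
    (fun N => by unfold bandWidth; omega) hR hC hγ hgrowth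

end Band

end BandMatrix

/-- The `limsup` is taken in the extended reals, so the conclusion contains the boundedness of the
sequence of norms. -/
theorem theorem4p4 {Ω : Type*} [MeasurableSpace Ω] (P : Measure Ω) [IsProbabilityMeasure P]
    (b : ℕ → ℕ) (X : ∀ N : ℕ, Ω → Matrix (Fin N) (Fin N) ℝ)
    (hmom : BandMatrix.AllMomentsExist P X)
    (C γ : ℝ) (hC : 0 < C) (hγ : 0 < γ)
    (hgrowth : ∀ N : ℕ, 1 ≤ N → C * (N : ℝ) ^ γ ≤ (BandMatrix.bandWidth b N : ℝ)) :
    (BandMatrix.IsBandedWigner P b X →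
      ∀ᵐ ω ∂P, limsup (fun N : ℕ =>
        ((BandMatrix.opNorm ((1 / √(BandMatrix.bandWidth b N : ℝ)) • X N ω) : ℝ) : EReal))
          atTop ≤ 2) ∧
    (BandMatrix.IsPeriodicBandedWigner P b X →
      ∀ᵐ ω ∂P, limsup (fun N : ℕ =>
        ((BandMatrix.opNorm ((1 / √(BandMatrix.bandWidth b N : ℝ)) • X N ω) : ℝ) : EReal))
          atTop ≤ 2) := by
  constructor
  · rintro ⟨-, Y, hY, hX⟩
    exact hY.ae_limsup_opNorm_le hC hγ hgrowth hmom
      (fun N i j => |((i : ℕ) : ℤ) - ((j : ℕ) : ℤ)| ≤ (b N : ℤ))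
      (fun N i j h => by rwa [abs_sub_comm]) (fun N i => by simp)
      (fun N i => BandMatrix.card_filter_abs_sub_le (b N) i) hX
  · rintro ⟨-, Y, hY, hX⟩
    exact hY.ae_limsup_opNorm_le hC hγ hgrowth hmom
      (fun N i j => BandMatrix.cyclicAbs N (((i : ℕ) : ℤ) - ((j : ℕ) : ℤ)) ≤ (b N : ℤ))
      (fun N i j h => by rwa [BandMatrix.cyclicAbs_sub_comm]) (fun N i => by
        simp [BandMatrix.cyclicAbs])
      (fun N i => BandMatrix.card_filter_cyclicAbs_le (b N) i) hX
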